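/- Let $F(\alpha,\beta,\gamma;x)$ be the principal branch (cut along $[1,\infty)$) of the Gauss hypergeometric function, and define the Seiberg–Witten periods of pure $SU(2)$ theory by $$a(z)=\Big(\tfrac{z+1}{2}\Big)^{1/2}F\Big(-\tfrac12,\tfrac12,1;\tfrac{2}{z+1}\Big),\qquad a_D(z)=i\,\tfrac{z-1}{2}\,F\Big(\tfrac12,\tfrac12,2;\tfrac{1-z}{2}\Big),$$ with principal branches, where on the cut $(-\infty,1]$ the functions take their boundary values from the upper half plane (in particular $a(-1)=2i/\pi$). Let $\mathcal C=\{z\in\mathbb C:\operatorname{Im}(a_D(z)/a(z))=0\}$ be the curve of marginal stability, and let $\mathcal M_+$ be the region outside $\mathcal C$, i.e. the set of points of $\mathbb C\setminus\mathcal C$ whose connected component in $\mathbb C\setminus\mathcal C$ is unbounded. Theorem. Let $p,q\in\mathbb R$ be not both zero and let $f(z)=p\,a(z)+q\,a_D(z)$. Let $z_0\in\mathcal C$ and $z\in\mathcal M_+$ be such that $\operatorname{Im}\big(f(z)/f(z_0)\big)=0$ and, if $q\neq0$, such that $f(z)$ and $f(z_0)$ are nonzero and have the same phase, i.e. $\operatorname{Re}\big(f(z)/f(z_0)\big)>0$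 (for $q=0$ this second condition need not be assumed). Then $|f(z)|>|f(z_0)|$. -/

import Mathlib

namespace SeibergWitten

noncomputable section

/-- The principal branch of the Gauss hypergeometric function `F(a, b, c; x)` for
`0 < Re b < Re c`, given by Euler's integral
`Γ(c) / (Γ(b) Γ(c - b)) * ∫₀¹ t ^ (b - 1) (1 - t) ^ (c - b - 1) (1 - x t) ^ (-a) dt`.
It is holomorphic off the cut `[1, ∞)`; on the cut, Mathlib's convention `arg ∈ (-π, π]` makes
it the limit from `Im x < 0`. -/
def hypergeom (a b c x : ℂ) : ℂ :=
  Complex.Gamma c / (Complex.Gamma b * Complex.Gamma (c - b)) *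
    ∫ t in (0 : ℝ)..1, (t : ℂ) ^ (b - 1) * (1 - (t : ℂ)) ^ (c - b - 1) * (1 - x * (t : ℂ)) ^ (-a)

/-- The period `a(z) = ((z + 1) / 2) ^ (1 / 2) F(-1/2, 1/2, 1; 2 / (z + 1))`, holomorphic off
`(-∞, 1]`. On the cut the formula gives the limit from the upper half plane; at `z = -1`,
where the formula has no meaning, that limit is `2 i / π`. -/
def a (z : ℂ) : ℂ :=
  if z = -1 then 2 * Complex.I / (Real.pi : ℂ)
  else ((z + 1) / 2) ^ (1 / 2 : ℂ) * hypergeom (-1 / 2) (1 / 2) 1 (2 / (z + 1))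

/-- The dual period `a_D(z) = i (z - 1) / 2 * F(1/2, 1/2, 2; (1 - z) / 2)`, holomorphic off
`(-∞, -1]`. On the cut the formula gives the limit from the upper half plane. -/
def aD (z : ℂ) : ℂ :=
  Complex.I * ((z - 1) / 2) * hypergeom (1 / 2) (1 / 2) 2 ((1 - z) / 2)

/-- The central charge `f(z) = p a(z) + q a_D(z)`. -/
def centralCharge (p q : ℝ) (z : ℂ) : ℂ := (p : ℂ) * a z + (q : ℂ) * aD z

/-- The curve of marginal stability `Im (a_D / a) = 0`. -/
def marginalCurve : Set ℂ := {z | (aD z / a z).im = 0}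

/-- The weak-coupling region: the region outside the (closed) curve of marginal stability,
i.e. the points whose connected component in the complement of the curve is unbounded. -/
def weakRegion : Set ℂ :=
  {z | z ∉ marginalCurve ∧ ¬ Bornology.IsBounded (connectedComponentIn marginalCurveᶜ z)}

end

end SeibergWitten

/-!
Write `K(u, v) = Im (conj u * v)` and let `π(z) = (a z, a_D z)` be the period vector. The curve of
marginal stability is the zero set of `K(π(z))`. Suppose `f(z) = c f(z₀)` with `c > 0` real. Then
`π(z) - c π(z₀)` is killed by the real linear form `(p, q)`, hence is a null vector of `K`, and
expanding `K` with `K(π(z₀)) = 0` gives `(c - 1) K(π(z)) = c K(π(z) - π(z₀))`. So `c > 1` once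
`K` is positive at `π(z)` and at `π(z) - π(z₀)`.

Put `ζ = (z + 1) / 2` with `Im ζ ≥ 0`. Averaging over the arcsine law of `t ∈ (0, 1)`, Euler's
integral for `F(-1/2, 1/2, 1; ·)` and, after an integration by parts, for `F(1/2, 1/2, 2; ·)` give
`a = E √(ζ - t)` and `a_D = 2 i E (ζ - 1) / (1 + √(1 + (ζ - 1) t))`. The difference quotients of
`a` and `a_D / 2 i` are then averages of reciprocals of sums of square roots, which all lie in the
closed fourth quadrant; this makes `K` positive on differences. Finally `K(π(z)) ≥ 0` outside a
bounded set, so `K(π(z)) > 0` on the unbounded components of the complement of the curve. The lower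
half plane is reached by `a (conj z) = conj (a z)` and `a_D (conj z) = -conj (a_D z)`.
-/

open Complex MeasureTheory ProbabilityTheory Set Filter Topology ComplexConjugate

namespace SeibergWitten

noncomputable section

section BetaMeasure

variable {α β : ℝ} {E : Type*} [NormedAddCommGroup E]

lemma measurable_betaPDF (α β : ℝ) : Measurable (betaPDF α β) :=
  (measurable_betaPDFReal α β).ennreal_ofReal

lemma betaMeasure_eq_withDensity_restrict (α β : ℝ) :
    betaMeasure α β = (volume.restrict (Ioo 0 1)).withDensity (betaPDF α β) := by
  rw [← restrict_withDensity measurableSet_Ioo, betaMeasure, Measure.restrict_eq_self_of_ae_mem]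
  refine (ae_withDensity_iff (measurable_betaPDF α β)).2 (.of_forall fun t => ?_)
  contrapose
  intro ht
  rw [betaPDF_eq, if_neg (mem_Ioo.not.1 ht), ENNReal.ofReal_zero]

lemma ae_betaMeasure_of_forall_mem_Ioo {p : ℝ → Prop} (h : ∀ t ∈ Ioo (0 : ℝ) 1, p t) :
    ∀ᵐ t ∂betaMeasure α β, p t := by
  rw [betaMeasure_eq_withDensity_restrict]
  exact (withDensity_absolutelyContinuous _ _).ae_le (ae_restrict_of_forall_mem measurableSet_Ioo h)

lemma restrict_Ioo_absolutelyContinuous_betaMeasure (hα : 0 < α) (hβ : 0 < β) :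
    volume.restrict (Ioo 0 1) ≪ betaMeasure α β := by
  rw [betaMeasure_eq_withDensity_restrict]
  refine withDensity_absolutelyContinuous' (measurable_betaPDF α β).aemeasurable ?_
  refine ae_restrict_of_forall_mem measurableSet_Ioo fun t ht => ?_
  exact (ENNReal.ofReal_pos.2 (betaPDFReal_pos ht.1 ht.2 hα hβ)).ne'

lemma toReal_betaPDF (hα : 0 < α) (hβ : 0 < β) {t : ℝ} (ht : t ∈ Ioo (0 : ℝ) 1) :
    (betaPDF α β t).toReal = (beta α β)⁻¹ * (t ^ (α - 1) * (1 - t) ^ (β - 1)) := by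
  rw [betaPDF, ENNReal.toReal_ofReal (betaPDFReal_pos ht.1 ht.2 hα hβ).le, betaPDFReal,
    if_pos (mem_Ioo.1 ht), one_div, mul_assoc]

lemma betaPDF_lt_top (α β t : ℝ) : betaPDF α β t < ⊤ := ENNReal.ofReal_lt_top

lemma integrable_betaMeasure_of_continuous (hα : 0 < α) (hβ : 0 < β) {f : ℝ → E}
    (hf : Continuous f) : Integrable f (betaMeasure α β) := by
  have := isProbabilityMeasureBeta hα hβ
  obtain ⟨C, hC⟩ := isCompact_Icc.exists_bound_of_continuousOn hf.continuousOn
  exact .of_bound hf.aestronglyMeasurable C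
    (ae_betaMeasure_of_forall_mem_Ioo fun t ht => hC t (Ioo_subset_Icc_self ht))

variable [NormedSpace ℝ E]

lemma integral_betaMeasure (hα : 0 < α) (hβ : 0 < β) (f : ℝ → E) :
    ∫ t, f t ∂betaMeasure α β =
      (beta α β)⁻¹ • ∫ t in Ioo 0 1, (t ^ (α - 1) * (1 - t) ^ (β - 1)) • f t := by
  rw [betaMeasure_eq_withDensity_restrict, integral_withDensity_eq_integral_toReal_smul
    (measurable_betaPDF α β) (.of_forall (betaPDF_lt_top α β)), ← integral_smul]
  refine setIntegral_congr_fun measurableSet_Ioo fun t ht => ?_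
  simp only [toReal_betaPDF hα hβ ht, mul_smul]

lemma integrable_betaMeasure_iff (hα : 0 < α) (hβ : 0 < β) {f : ℝ → E} :
    Integrable f (betaMeasure α β) ↔
      IntegrableOn (fun t => (t ^ (α - 1) * (1 - t) ^ (β - 1)) • f t) (Ioo 0 1) := by
  rw [betaMeasure_eq_withDensity_restrict, integrable_withDensity_iff_integrable_smul'
    (measurable_betaPDF α β) (.of_forall (betaPDF_lt_top α β)), ← IntegrableOn,
    integrableOn_congr_fun (g := fun t => (beta α β)⁻¹ • (t ^ (α - 1) * (1 - t) ^ (β - 1)) • f t)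
      (fun t ht => by simp only [toReal_betaPDF hα hβ ht, mul_smul]) measurableSet_Ioo]
  exact integrable_smul_iff (inv_ne_zero (beta_pos hα hβ).ne') _

lemma integral_betaMeasure_comp_one_sub (hα : 0 < α) (hβ : 0 < β) (f : ℝ → E) :
    ∫ t, f (1 - t) ∂betaMeasure α β = ∫ t, f t ∂betaMeasure β α := by
  have reflect := intervalIntegral.integral_comp_sub_left (a := 0) (b := 1)
    (fun t : ℝ => (t ^ (β - 1) * (1 - t) ^ (α - 1)) • f t) 1
  simp only [sub_sub_cancel, sub_zero, sub_self] at reflect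
  rw [integral_betaMeasure hα hβ, integral_betaMeasure hβ hα, ← integral_Ioc_eq_integral_Ioo,
    ← integral_Ioc_eq_integral_Ioo, ← intervalIntegral.integral_of_le zero_le_one,
    ← intervalIntegral.integral_of_le zero_le_one, ← reflect]
  simp only [beta, mul_comm, add_comm]

lemma integral_rpow_betaMeasure {s : ℝ} (hα : 0 < α) (hs : 0 < α + s) (hβ : 0 < β) :
    ∫ t, t ^ s ∂betaMeasure α β = beta (α + s) β / beta α β := by
  have mass : ∫ _, (1 : ℝ) ∂betaMeasure (α + s) β = 1 := by
    have := isProbabilityMeasureBeta hs hβ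
    simp
  have tilt : ∫ t in Ioo (0 : ℝ) 1, t ^ (α + s - 1) * (1 - t) ^ (β - 1) = beta (α + s) β := by
    rw [integral_betaMeasure hs hβ] at mass
    simpa only [smul_eq_mul, mul_one, inv_mul_eq_one₀ (beta_pos hs hβ).ne', eq_comm] using mass
  rw [integral_betaMeasure hα hβ, smul_eq_mul, ← tilt, inv_mul_eq_div]
  congr 1
  refine setIntegral_congr_fun measurableSet_Ioo fun t ht => ?_
  rw [smul_eq_mul, mul_right_comm, ← Real.rpow_add ht.1]
  ring_nf

lemma continuous_integral_betaMeasure (hα : 0 < α) (hβ : 0 < β) {X : Type*} [TopologicalSpace X]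
    [FirstCountableTopology X] [LocallyCompactSpace X] {f : X → ℝ → E}
    (hf : Continuous f.uncurry) : Continuous fun x => ∫ t, f x t ∂betaMeasure α β := by
  have := isProbabilityMeasureBeta hα hβ
  have mem : ∀ᵐ t ∂betaMeasure α β, t ∈ Icc (0 : ℝ) 1 :=
    ae_betaMeasure_of_forall_mem_Ioo fun t ht => Ioo_subset_Icc_self ht
  rw [← Measure.restrict_eq_self_of_ae_mem mem]
  exact continuous_parametric_integral_of_continuous hf isCompact_Icc

lemma integral_betaMeasure_pos (hα : 0 < α) (hβ : 0 < β) {f : ℝ → ℝ} (hf : Continuous f)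
    (nonneg : ∀ t ∈ Icc (0 : ℝ) 1, 0 ≤ f t) {t₀ : ℝ} (ht₀ : t₀ ∈ Icc (0 : ℝ) 1)
    (pos : 0 < f t₀) : 0 < ∫ t, f t ∂betaMeasure α β := by
  have nonneg_ae : 0 ≤ᵐ[betaMeasure α β] f :=
    ae_betaMeasure_of_forall_mem_Ioo fun t ht => nonneg t (Ioo_subset_Icc_self ht)
  refine (integral_nonneg_of_ae nonneg_ae).lt_of_ne' fun h => pos.ne' ?_
  have zero_ae : f =ᵐ[volume.restrict (Icc 0 1)] 0 := by
    rw [← restrict_Ioo_eq_restrict_Icc]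
    exact (restrict_Ioo_absolutelyContinuous_betaMeasure hα hβ).ae_le
      ((integral_eq_zero_iff_of_nonneg_ae nonneg_ae
        (integrable_betaMeasure_of_continuous hα hβ hf)).1 h)
  exact Measure.eqOn_Icc_of_ae_eq _ zero_ne_one zero_ae hf.continuousOn continuousOn_const ht₀

lemma beta_comm (α β : ℝ) : beta α β = beta β α := by rw [beta, beta, mul_comm, add_comm]

lemma beta_half_half : beta (1 / 2) (1 / 2) = Real.pi := by
  rw [beta, Real.Gamma_one_half_eq, Real.mul_self_sqrt Real.pi_pos.le, add_halves, Real.Gamma_one,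
    div_one]

lemma beta_half_three_halves : beta (1 / 2) (3 / 2) = Real.pi / 2 := by
  rw [beta, show (3 / 2 : ℝ) = 1 / 2 + 1 by norm_num, Real.Gamma_add_one (by norm_num),
    show (1 / 2 + (1 / 2 + 1) : ℝ) = (1 : ℕ) + 1 by norm_num, Real.Gamma_nat_eq_factorial,
    Real.Gamma_one_half_eq, mul_left_comm, Real.mul_self_sqrt Real.pi_pos.le, Nat.factorial_one]
  ring

lemma beta_one_half : beta 1 (1 / 2) = 2 := by
  rw [beta, add_comm, Real.Gamma_add_one (by norm_num), Real.Gamma_one, one_mul, mul_comm,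
    div_mul_cancel_left₀ (Real.Gamma_pos_of_pos (by norm_num)).ne']
  norm_num

end BetaMeasure

section Hypergeometric

lemma hypergeom_eq_integral_betaMeasure {b c : ℝ} (hb : 0 < b) (hc : b < c) (a x : ℂ) :
    hypergeom a b c x = ∫ t : ℝ, (1 - x * t) ^ (-a) ∂betaMeasure b (c - b) := by
  have weight {t : ℝ} (ht : t ∈ Ioo (0 : ℝ) 1) :
      (t : ℂ) ^ ((b : ℂ) - 1) * (1 - (t : ℂ)) ^ ((c : ℂ) - b - 1) =
        (t ^ (b - 1) * (1 - t) ^ (c - b - 1) : ℝ) := by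
    rw [ofReal_mul, ofReal_cpow ht.1.le, ofReal_cpow (sub_pos.2 ht.2).le]
    push_cast
    rfl
  rw [integral_betaMeasure hb (sub_pos.2 hc), hypergeom,
    intervalIntegral.integral_of_le zero_le_one, integral_Ioc_eq_integral_Ioo,
    setIntegral_congr_fun measurableSet_Ioo
      fun t ht => by simp only [weight ht, ← real_smul]; rfl, real_smul, beta]
  simp only [← ofReal_sub, Gamma_ofReal, inv_div, add_sub_cancel, ofReal_div, ofReal_mul]

lemma hypergeom_conj {a b c : ℝ} (hb : 0 < b) (hc : b < c) {x : ℂ} (hx : x.im ≠ 0) :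
    hypergeom a b c (conj x) = conj (hypergeom a b c x) := by
  rw [hypergeom_eq_integral_betaMeasure hb hc, hypergeom_eq_integral_betaMeasure hb hc,
    ← integral_conj]
  refine integral_congr_ae (ae_betaMeasure_of_forall_mem_Ioo fun t ht => ?_)
  have arg_ne_pi : (1 - x * t).arg ≠ Real.pi := fun h => by
    simpa [hx, ht.1.ne'] using (arg_eq_pi_iff.1 h).2
  simpa using conj_cpow _ (-a : ℂ) arg_ne_pi

end Hypergeometric

section UpperSqrt

/-- The continuous function on `ℂ` which on the closed upper half plane is the principal square
root; it is even in `Im w`, so it squares to `w` only for `0 ≤ Im w`. -/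
def upperSqrt (w : ℂ) : ℂ := ⟨√((‖w‖ + w.re) / 2), √((‖w‖ - w.re) / 2)⟩

lemma upperSqrt_re_nonneg (w : ℂ) : 0 ≤ (upperSqrt w).re := Real.sqrt_nonneg _

lemma upperSqrt_im_nonneg (w : ℂ) : 0 ≤ (upperSqrt w).im := Real.sqrt_nonneg _

lemma upperSqrt_re_pos {w : ℂ} (hw : w ∈ slitPlane) : 0 < (upperSqrt w).re := by
  refine Real.sqrt_pos.2 (half_pos ?_)
  rcases hw with hre | him
  · positivity
  · linarith [abs_re_lt_norm.2 him, neg_abs_le w.re]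

lemma upperSqrt_im_pos {w : ℂ} (hw : -w ∈ slitPlane) : 0 < (upperSqrt w).im := by
  simpa [upperSqrt, add_comm, sub_eq_add_neg] using upperSqrt_re_pos hw

lemma continuous_upperSqrt : Continuous upperSqrt := by
  have : upperSqrt = fun w => equivRealProdCLM.symm (√((‖w‖ + w.re) / 2), √((‖w‖ - w.re) / 2)) := by
    funext w
    apply Complex.ext <;> simp [upperSqrt]
  rw [this]
  fun_prop

lemma cpow_inv_two_eq_upperSqrt {w : ℂ} (hw : 0 ≤ w.im) : w ^ (2⁻¹ : ℂ) = upperSqrt w :=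
  Complex.ext (cpow_inv_two_re w) (cpow_inv_two_im_eq_sqrt hw)

lemma upperSqrt_sq {w : ℂ} (hw : 0 ≤ w.im) : upperSqrt w ^ 2 = w := by
  rw [← cpow_inv_two_eq_upperSqrt hw]
  exact cpow_nat_inv_pow w two_ne_zero

lemma upperSqrt_sq_of_nonneg {u : ℂ} (hre : 0 ≤ u.re) (him : 0 ≤ u.im) :
    upperSqrt (u ^ 2) = u := by
  have norm_sq : ‖u ^ 2‖ = u.re ^ 2 + u.im ^ 2 := by
    rw [norm_pow, ← normSq_eq_norm_sq, normSq_apply, sq, sq]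
  have re_sq : (u ^ 2).re = u.re ^ 2 - u.im ^ 2 := by simp [sq]
  apply Complex.ext
  · rw [upperSqrt, norm_sq, re_sq, show (u.re ^ 2 + u.im ^ 2 + (u.re ^ 2 - u.im ^ 2)) / 2 = u.re ^ 2
      by ring, Real.sqrt_sq hre]
  · rw [upperSqrt, norm_sq, re_sq, show (u.re ^ 2 + u.im ^ 2 - (u.re ^ 2 - u.im ^ 2)) / 2 = u.im ^ 2
      by ring, Real.sqrt_sq him]

lemma upperSqrt_ofReal_of_nonneg {x : ℝ} (hx : 0 ≤ x) : upperSqrt x = √x := by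
  apply Complex.ext <;> simp [upperSqrt, abs_of_nonneg hx]

lemma upperSqrt_neg_ofReal {x : ℝ} (hx : 0 ≤ x) : upperSqrt (-x) = √x * I := by
  apply Complex.ext <;> simp [upperSqrt, abs_of_nonneg hx]

lemma upperSqrt_sub_ofReal_re_le (w : ℂ) {t : ℝ} (ht : 0 ≤ t) :
    (upperSqrt (w - t)).re ≤ (upperSqrt w).re := by
  have triangle := norm_sub_le w t
  rw [norm_real, Real.norm_of_nonneg ht] at triangle
  refine Real.sqrt_le_sqrt ?_
  rw [sub_re, ofReal_re]
  linarith

lemma upperSqrt_im_le_sub_ofReal_im (w : ℂ) {t : ℝ} (ht : 0 ≤ t) :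
    (upperSqrt w).im ≤ (upperSqrt (w - t)).im := by
  have triangle := norm_sub_norm_le w t
  rw [norm_real, Real.norm_of_nonneg ht] at triangle
  refine Real.sqrt_le_sqrt ?_
  rw [sub_re, ofReal_re]
  linarith

lemma upperSqrt_sub_ofReal {w : ℂ} (hw : 0 ≤ w.im) (h0 : w ≠ 0) {t : ℝ} (ht : 0 ≤ t) :
    upperSqrt (w - t) = upperSqrt w * upperSqrt (1 - t / w) := by
  set u := upperSqrt (w - t)
  set v := upperSqrt w
  have v_sq : v ^ 2 = w := upperSqrt_sq hw
  have v_ne_zero : v ≠ 0 := fun h => h0 (by rw [← v_sq, h, zero_pow two_ne_zero])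
  have quotient_re : 0 ≤ (u / v).re := by
    rw [div_re]
    exact add_nonneg
      (div_nonneg (mul_nonneg (upperSqrt_re_nonneg _) (upperSqrt_re_nonneg _)) (normSq_nonneg v))
      (div_nonneg (mul_nonneg (upperSqrt_im_nonneg _) (upperSqrt_im_nonneg _)) (normSq_nonneg v))
  have quotient_im : 0 ≤ (u / v).im := by
    rw [div_im, ← sub_div]
    refine div_nonneg (sub_nonneg.2 ?_) (normSq_nonneg v)
    rw [mul_comm u.im]
    exact mul_le_mul (upperSqrt_sub_ofReal_re_le w ht) (upperSqrt_im_le_sub_ofReal_im w ht)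
      (upperSqrt_im_nonneg _) (upperSqrt_re_nonneg _)
  have quotient_sq : (u / v) ^ 2 = 1 - t / w := by
    rw [div_pow, v_sq, upperSqrt_sq (by simpa using hw), sub_div, div_self h0]
  rw [← quotient_sq, upperSqrt_sq_of_nonneg quotient_re quotient_im, mul_div_cancel₀ _ v_ne_zero]

end UpperSqrt

section Periods

/-- The arcsine law, against which both periods are averages. -/
abbrev arcsineMeasure : Measure ℝ := betaMeasure (1 / 2) (1 / 2)

instance : IsProbabilityMeasure arcsineMeasure := isProbabilityMeasureBeta one_half_pos one_half_pos

/-- The period `a` on the closed upper half plane, in the coordinate `ζ = (z + 1) / 2`. -/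
def upperPeriod (ζ : ℂ) : ℂ := ∫ t : ℝ, upperSqrt (ζ - t) ∂arcsineMeasure

/-- The square root of `1 - x t` at the argument `x = 1 - ζ` of the hypergeometric function in
`a_D`. -/
def dualRoot (ζ : ℂ) (t : ℝ) : ℂ := upperSqrt (1 + (ζ - 1) * t)

/-- The function averaged in the dual period; `t * dualKernel ζ t = dualRoot ζ t - 1`. -/
def dualKernel (ζ : ℂ) (t : ℝ) : ℂ := (ζ - 1) / (1 + dualRoot ζ t)

/-- The period `a_D` on the closed upper half plane, in the coordinate `ζ = (z + 1) / 2`. -/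
def upperDualPeriod (ζ : ℂ) : ℂ := 2 * I * ∫ t, dualKernel ζ t ∂arcsineMeasure

lemma continuous_upperSqrt_sub : Continuous fun p : ℂ × ℝ => upperSqrt (p.1 - p.2) :=
  continuous_upperSqrt.comp (by fun_prop)

lemma continuous_uncurry_dualRoot : Continuous (Function.uncurry dualRoot) := by
  unfold Function.uncurry dualRoot
  exact continuous_upperSqrt.comp (by fun_prop)

@[fun_prop]
lemma continuous_dualRoot (ζ : ℂ) : Continuous (dualRoot ζ) :=
  continuous_uncurry_dualRoot.uncurry_left ζ

lemma dualRoot_sq {ζ : ℂ} (hζ : 0 ≤ ζ.im) {t : ℝ} (ht : 0 ≤ t) :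
    dualRoot ζ t ^ 2 = 1 + (ζ - 1) * t :=
  upperSqrt_sq (by simpa using mul_nonneg hζ ht)

lemma dualRoot_re_nonneg (ζ : ℂ) (t : ℝ) : 0 ≤ (dualRoot ζ t).re := upperSqrt_re_nonneg _

lemma dualRoot_im_nonneg (ζ : ℂ) (t : ℝ) : 0 ≤ (dualRoot ζ t).im := upperSqrt_im_nonneg _

lemma one_add_dualRoot_ne_zero (ζ : ℂ) (t : ℝ) : 1 + dualRoot ζ t ≠ 0 := by
  intro h
  have := congrArg Complex.re h
  simp only [add_re, one_re, zero_re] at this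
  linarith [dualRoot_re_nonneg ζ t]

lemma continuous_uncurry_dualKernel : Continuous (Function.uncurry dualKernel) := by
  unfold Function.uncurry dualKernel
  exact (by fun_prop : Continuous fun p : ℂ × ℝ => p.1 - 1).div
    (continuous_const.add continuous_uncurry_dualRoot) fun p => one_add_dualRoot_ne_zero p.1 p.2

lemma continuous_upperPeriod : Continuous upperPeriod :=
  continuous_integral_betaMeasure one_half_pos one_half_pos continuous_upperSqrt_sub

lemma continuous_upperDualPeriod : Continuous upperDualPeriod :=
  continuous_const.mul
    (continuous_integral_betaMeasure one_half_pos one_half_pos continuous_uncurry_dualKernel)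

lemma integrable_upperSqrt_sub (ζ : ℂ) :
    Integrable (fun t : ℝ => upperSqrt (ζ - t)) arcsineMeasure :=
  integrable_betaMeasure_of_continuous one_half_pos one_half_pos
    (continuous_upperSqrt_sub.comp (Continuous.prodMk_right ζ))

lemma integrable_dualKernel (ζ : ℂ) : Integrable (dualKernel ζ) arcsineMeasure :=
  integrable_betaMeasure_of_continuous one_half_pos one_half_pos
    (continuous_uncurry_dualKernel.uncurry_left ζ)

lemma upperPeriod_zero : upperPeriod 0 = 2 * I / Real.pi := by
  have pointwise : ∀ᵐ t : ℝ ∂arcsineMeasure, upperSqrt (0 - t) = ((t ^ (1 / 2 : ℝ) : ℝ) : ℂ) * I :=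
    ae_betaMeasure_of_forall_mem_Ioo fun t ht => by
      rw [zero_sub, upperSqrt_neg_ofReal ht.1.le, Real.sqrt_eq_rpow]
  rw [upperPeriod, integral_congr_ae pointwise, integral_mul_const, integral_complex_ofReal,
    integral_rpow_betaMeasure one_half_pos (by norm_num) one_half_pos, beta_half_half, add_halves,
    beta_one_half]
  push_cast
  ring

lemma upperPeriod_eq_mul_hypergeom {ζ : ℂ} (hζ : 0 ≤ ζ.im) (h0 : ζ ≠ 0) :
    upperPeriod ζ = ζ ^ (1 / 2 : ℂ) * hypergeom (-1 / 2) (1 / 2) 1 (1 / ζ) := by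
  have euler := hypergeom_eq_integral_betaMeasure (b := 1 / 2) (c := 1) one_half_pos
    one_half_lt_one (-1 / 2) (1 / ζ)
  push_cast at euler
  rw [euler, one_div, cpow_inv_two_eq_upperSqrt hζ, ← integral_const_mul, upperPeriod, sub_half]
  refine integral_congr_ae (ae_betaMeasure_of_forall_mem_Ioo fun t ht => ?_)
  have im_nonneg : 0 ≤ (1 - ζ⁻¹ * t).im := by
    simpa [inv_im, neg_div] using mul_nonneg (div_nonneg hζ (normSq_nonneg ζ)) ht.1.le
  simp only
  rw [show -(-1 / 2 : ℂ) = 2⁻¹ by norm_num, one_div, cpow_inv_two_eq_upperSqrt im_nonneg,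
    inv_mul_eq_div, upperSqrt_sub_ofReal hζ h0 ht.1.le]

lemma im_add_one_div_two_nonneg {z : ℂ} (hz : 0 ≤ z.im) : 0 ≤ ((z + 1) / 2).im := by
  simpa using div_nonneg hz zero_le_two

lemma a_eq_upperPeriod {z : ℂ} (hz : 0 ≤ z.im) : a z = upperPeriod ((z + 1) / 2) := by
  rw [a]
  split_ifs with h
  · rw [h, neg_add_cancel, zero_div, upperPeriod_zero]
  · rw [← one_div_div (z + 1) 2, ← upperPeriod_eq_mul_hypergeom (im_add_one_div_two_nonneg hz)
      (div_ne_zero (fun h' => h (eq_neg_of_add_eq_zero_left h')) two_ne_zero)]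

end Periods

section DualPeriod

lemma hasDerivAt_of_sq {𝕜 F : Type*} [NontriviallyNormedField 𝕜] [NormedField F]
    [NormedAlgebra 𝕜 F] [NeZero (2 : F)] {f g : 𝕜 → F} {g' : F} {x : 𝕜} (hg : HasDerivAt g g' x)
    (hf : ContinuousAt f x) (hfg : ∀ᶠ y in 𝓝 x, f y ^ 2 = g y) (h0 : f x ≠ 0) :
    HasDerivAt f (g' / (2 * f x)) x := by
  have sum_tendsto : Tendsto (fun y => f y + f x) (𝓝[≠] x) (𝓝 (2 * f x)) := by
    rw [two_mul]
    exact (hf.tendsto.mono_left nhdsWithin_le_nhds).add_const _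
  have two_mul_ne_zero : 2 * f x ≠ 0 := mul_ne_zero two_ne_zero h0
  rw [hasDerivAt_iff_tendsto_slope] at hg ⊢
  refine (hg.div sum_tendsto two_mul_ne_zero).congr' ?_
  filter_upwards [sum_tendsto.eventually_ne two_mul_ne_zero, hfg.filter_mono nhdsWithin_le_nhds]
    with y sum_ne_zero sq_eq
  rw [Pi.div_apply, slope_def_module, slope_def_module, ← sq_eq, ← hfg.self_of_nhds, sq_sub_sq,
    smul_div_assoc, mul_div_cancel_left₀ _ sum_ne_zero]

lemma rpow_neg_mul_rpow_neg_abs_one_sub_mul_le {r : ℝ} (hr₀ : 0 ≤ r) (hr₁ : r ≤ 1) (c : ℝ) {t : ℝ}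
    (ht : 0 < t) :
    t ^ (-r) * |1 - c * t| ^ (-r) ≤ t ^ (-r) + |c| ^ r * |1 - c * t| ^ (-r) := by
  have ht_pow : 0 < t ^ r := Real.rpow_pos_of_pos ht r
  have one_le : 1 ≤ |1 - c * t| ^ r + |c| ^ r * t ^ r := by
    have triangle : 1 ≤ |1 - c * t| + |c| * t := by
      rw [← abs_of_pos ht, ← abs_mul, abs_of_pos ht]
      simpa using abs_add_le (1 - c * t) (c * t)
    rw [← Real.mul_rpow (abs_nonneg c) ht.le]
    exact (Real.one_le_rpow triangle hr₀).trans
      (Real.rpow_add_le_add_rpow (abs_nonneg _) (by positivity) hr₀ hr₁)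
  rw [Real.rpow_neg ht.le, Real.rpow_neg (abs_nonneg _)]
  set x := t ^ r
  set y := |1 - c * t| ^ r
  have _ : 0 ≤ y := Real.rpow_nonneg (abs_nonneg _) r
  calc x⁻¹ * y⁻¹ ≤ x⁻¹ * y⁻¹ * (y + |c| ^ r * x) := le_mul_of_one_le_right (by positivity) one_le
    _ = x⁻¹ * (y⁻¹ * y) + |c| ^ r * y⁻¹ := by field_simp
    _ ≤ x⁻¹ + |c| ^ r * y⁻¹ := by
      gcongr
      exact mul_le_of_le_one_right (by positivity) inv_mul_le_one

lemma intervalIntegrable_rpow_abs_one_sub_mul {s : ℝ} (hs : -1 < s) (c : ℝ) :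
    IntervalIntegrable (fun t => |1 - c * t| ^ s) volume 0 1 := by
  rcases eq_or_ne c 0 with rfl | hc
  · simp
  have base : IntervalIntegrable (fun y : ℝ => |y| ^ s) volume 1 (1 - c) := by
    have := (intervalIntegral.intervalIntegrable_cpow' (a := 1) (b := 1 - c) (r := s)
      (by rwa [ofReal_re])).norm
    simpa only [norm_cpow_real, norm_real, Real.norm_eq_abs] using this
  simpa [hc] using (base.comp_sub_left 1).comp_mul_left (c := c)

lemma integrableOn_rpow_neg_mul_rpow_neg_abs_one_sub_mul {r : ℝ} (hr₀ : 0 ≤ r) (hr₁ : r < 1)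
    (c : ℝ) : IntegrableOn (fun t => t ^ (-r) * |1 - c * t| ^ (-r)) (Ioo 0 1) := by
  have majorant : IntegrableOn (fun t => t ^ (-r) + |c| ^ r * |1 - c * t| ^ (-r)) (Ioo 0 1) :=
    ((intervalIntegrable_iff_integrableOn_Ioo_of_le zero_le_one).1
      (intervalIntegral.intervalIntegrable_rpow' (neg_lt_neg hr₁))).add
      (((intervalIntegrable_iff_integrableOn_Ioo_of_le zero_le_one).1
        (intervalIntegrable_rpow_abs_one_sub_mul (neg_lt_neg hr₁) c)).const_mul _)
  refine majorant.mono' (by fun_prop) (ae_restrict_of_forall_mem measurableSet_Ioo fun t ht => ?_)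
  rw [Real.norm_of_nonneg (by have := ht.1; positivity)]
  exact rpow_neg_mul_rpow_neg_abs_one_sub_mul_le hr₀ hr₁.le c ht.1

lemma norm_inv_dualRoot {ζ : ℂ} (hζ : 0 ≤ ζ.im) {t : ℝ} (ht : 0 ≤ t) :
    ‖(dualRoot ζ t)⁻¹‖ = ‖1 + (ζ - 1) * t‖ ^ (-(1 / 2) : ℝ) := by
  rw [norm_inv, Real.rpow_neg (norm_nonneg _), ← Real.sqrt_eq_rpow, ← dualRoot_sq hζ ht, norm_pow,
    Real.sqrt_sq (norm_nonneg _)]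

lemma norm_inv_dualRoot_le {ζ : ℂ} (hζ : 0 ≤ ζ.im) {t : ℝ} (ht : 0 ≤ t)
    (ht' : t ≠ (1 - ζ.re)⁻¹) :
    ‖(dualRoot ζ t)⁻¹‖ ≤ |1 - (1 - ζ.re) * t| ^ (-(1 / 2) : ℝ) := by
  have ne_zero : 1 - (1 - ζ.re) * t ≠ 0 := fun h =>
    ht' (eq_inv_of_mul_eq_one_right (sub_eq_zero.1 h).symm)
  have re_eq : (1 + (ζ - 1) * t).re = 1 - (1 - ζ.re) * t := by
    simp
    ring
  rw [norm_inv_dualRoot hζ ht, ← re_eq]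
  exact Real.rpow_le_rpow_of_nonpos (abs_pos.2 (re_eq ▸ ne_zero)) (abs_re_le_norm _) (by norm_num)

lemma integrable_inv_dualRoot {ζ : ℂ} (hζ : 0 ≤ ζ.im) :
    Integrable (fun t => (dualRoot ζ t)⁻¹) (betaMeasure (1 / 2) (3 / 2)) := by
  rw [integrable_betaMeasure_iff (by norm_num) (by norm_num)]
  have _ : Measurable (dualRoot ζ) := (continuous_dualRoot ζ).measurable
  refine (integrableOn_rpow_neg_mul_rpow_neg_abs_one_sub_mul one_half_pos.le one_half_lt_one
    (1 - ζ.re)).mono' (by fun_prop) ?_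
  filter_upwards [ae_restrict_mem measurableSet_Ioo, Measure.ae_ne _ (1 - ζ.re)⁻¹] with t ht ht'
  have ht₀ : 0 < t := ht.1
  have ht₁ : 0 < 1 - t := sub_pos.2 ht.2
  rw [norm_smul, Real.norm_of_nonneg (by positivity), show (1 / 2 - 1 : ℝ) = -(1 / 2) by norm_num]
  gcongr
  · exact mul_le_of_le_one_right (by positivity)
      (Real.rpow_le_one ht₁.le (sub_le_self 1 ht₀.le) (by norm_num))
  · exact norm_inv_dualRoot_le hζ ht₀.le ht'

lemma countable_dualRoot_eq_zero {ζ : ℂ} (hζ : 0 ≤ ζ.im) :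
    ({t | dualRoot ζ t = 0} ∩ Ioo 0 1).Countable := by
  have root_eq {t : ℝ} (ht : t ∈ {t | dualRoot ζ t = 0} ∩ Ioo 0 1) : (t : ℂ) = (1 - ζ)⁻¹ := by
    have radicand_eq := dualRoot_sq hζ ht.2.1.le
    rw [show dualRoot ζ t = 0 from ht.1] at radicand_eq
    exact eq_inv_of_mul_eq_one_right (by linear_combination radicand_eq)
  exact Subsingleton.countable fun s hs t ht =>
    ofReal_injective ((root_eq hs).trans (root_eq ht).symm)

lemma hasDerivAt_dualRoot {ζ : ℂ} (hζ : 0 ≤ ζ.im) {t : ℝ} (ht : 0 < t) (h0 : dualRoot ζ t ≠ 0) :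
    HasDerivAt (dualRoot ζ) ((ζ - 1) / (2 * dualRoot ζ t)) t := by
  have radicand : HasDerivAt (fun s : ℝ => 1 + (ζ - 1) * s) (ζ - 1) t := by
    simpa using ((hasDerivAt_id t).ofReal_comp.const_mul (ζ - 1)).const_add 1
  refine hasDerivAt_of_sq radicand (continuous_dualRoot ζ).continuousAt ?_ h0
  filter_upwards [lt_mem_nhds ht] with s hs using dualRoot_sq hζ hs.le

lemma hasDerivAt_two_mul_sqrt_mul_sqrt_div_one_add_dualRoot {ζ : ℂ} (hζ : 0 ≤ ζ.im) {t : ℝ}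
    (ht : t ∈ Ioo (0 : ℝ) 1) (h0 : dualRoot ζ t ≠ 0) :
    HasDerivAt (fun s : ℝ => ((2 * (√s * √(1 - s)) : ℝ) : ℂ) / (1 + dualRoot ζ s))
      ((t ^ (1 / 2 - 1 : ℝ) * (1 - t) ^ (3 / 2 - 1 : ℝ)) • (dualRoot ζ t)⁻¹ -
        (t ^ (1 / 2 - 1 : ℝ) * (1 - t) ^ (1 / 2 - 1 : ℝ)) • (1 + dualRoot ζ t)⁻¹) t := by
  have ht₀ : 0 < √t := Real.sqrt_pos.2 ht.1
  have ht₁ : 0 < √(1 - t) := Real.sqrt_pos.2 (sub_pos.2 ht.2)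
  have numerator : HasDerivAt (fun s : ℝ => 2 * (√s * √(1 - s)))
      (2 * (1 / (2 * √t) * √(1 - t) + √t * (-1 / (2 * √(1 - t))))) t :=
    ((Real.hasDerivAt_sqrt ht.1.ne').mul
      (((hasDerivAt_id t).const_sub 1).sqrt (sub_pos.2 ht.2).ne')).const_mul 2
  refine (numerator.ofReal_comp.div ((hasDerivAt_dualRoot hζ ht.1 h0).const_add 1)
    (one_add_dualRoot_ne_zero ζ t)).congr_deriv ?_
  have q_sq := dualRoot_sq hζ ht.1.le
  have x_sq : ((√t : ℝ) : ℂ) ^ 2 = t := by rw [← ofReal_pow, Real.sq_sqrt ht.1.le]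
  have y_sq : ((√(1 - t) : ℝ) : ℂ) ^ 2 = 1 - t := by
    rw [← ofReal_pow, Real.sq_sqrt (sub_pos.2 ht.2).le, ofReal_sub, ofReal_one]
  have hx : ((√t : ℝ) : ℂ) ≠ 0 := ofReal_ne_zero.2 ht₀.ne'
  have hy : ((√(1 - t) : ℝ) : ℂ) ≠ 0 := ofReal_ne_zero.2 ht₁.ne'
  have hq := one_add_dualRoot_ne_zero ζ t
  rw [show (1 / 2 - 1 : ℝ) = -(1 / 2) by norm_num, show (3 / 2 - 1 : ℝ) = 1 / 2 by norm_num,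
    Real.rpow_neg ht.1.le, Real.rpow_neg (sub_pos.2 ht.2).le, ← Real.sqrt_eq_rpow,
    ← Real.sqrt_eq_rpow, real_smul, real_smul]
  push_cast
  generalize ((√t : ℝ) : ℂ) = x at *
  generalize ((√(1 - t) : ℝ) : ℂ) = y at *
  generalize dualRoot ζ t = q at *
  have key : (ζ - 1) * x ^ 2 = q ^ 2 - 1 := by rw [x_sq, q_sq]; ring
  have xy : x ^ 2 + y ^ 2 = 1 := by rw [x_sq, y_sq]; ring
  field_simp
  linear_combination -y ^ 2 * key - (1 + q) * q * xy

lemma integrable_inv_one_add_dualRoot (ζ : ℂ) :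
    Integrable (fun t => (1 + dualRoot ζ t)⁻¹) arcsineMeasure :=
  integrable_betaMeasure_of_continuous one_half_pos one_half_pos
    ((continuous_const.add (continuous_dualRoot ζ)).inv₀ (one_add_dualRoot_ne_zero ζ))

lemma setIntegral_smul_inv_dualRoot {ζ : ℂ} (hζ : 0 ≤ ζ.im) :
    ∫ t in Ioo (0 : ℝ) 1, (t ^ (1 / 2 - 1 : ℝ) * (1 - t) ^ (3 / 2 - 1 : ℝ)) • (dualRoot ζ t)⁻¹ =
      ∫ t in Ioo (0 : ℝ) 1,
        (t ^ (1 / 2 - 1 : ℝ) * (1 - t) ^ (1 / 2 - 1 : ℝ)) • (1 + dualRoot ζ t)⁻¹ := by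
  have integrable_inv := (integrable_betaMeasure_iff (by norm_num) (by norm_num)).1
    (integrable_inv_dualRoot hζ)
  have integrable_inv_one_add := (integrable_betaMeasure_iff one_half_pos one_half_pos).1
    (integrable_inv_one_add_dualRoot ζ)
  have continuous_primitive :
      Continuous fun t : ℝ => ((2 * (√t * √(1 - t)) : ℝ) : ℂ) / (1 + dualRoot ζ t) :=
    .div (by fun_prop) (by fun_prop) (one_add_dualRoot_ne_zero ζ)
  rw [← sub_eq_zero, ← integral_sub integrable_inv integrable_inv_one_add,
    ← integral_Ioc_eq_integral_Ioo, ← intervalIntegral.integral_of_le zero_le_one,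
    integral_eq_of_hasDerivAt_off_countable_of_le _ _ zero_le_one (countable_dualRoot_eq_zero hζ)
      continuous_primitive.continuousOn
      (fun t ht => hasDerivAt_two_mul_sqrt_mul_sqrt_div_one_add_dualRoot hζ ht.1
        fun h => ht.2 ⟨h, ht.1⟩)]
  · simp
  · exact (intervalIntegrable_iff_integrableOn_Ioo_of_le zero_le_one).2
      (integrable_inv.sub integrable_inv_one_add)

lemma integral_inv_dualRoot {ζ : ℂ} (hζ : 0 ≤ ζ.im) :
    ∫ t, (dualRoot ζ t)⁻¹ ∂betaMeasure (1 / 2) (3 / 2) =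
      2 * ∫ t, (1 + dualRoot ζ t)⁻¹ ∂arcsineMeasure := by
  rw [integral_betaMeasure (by norm_num) (by norm_num), integral_betaMeasure one_half_pos
    one_half_pos, setIntegral_smul_inv_dualRoot hζ, beta_half_half, beta_half_three_halves,
    real_smul, real_smul]
  push_cast
  rw [← mul_assoc, inv_div, div_eq_mul_inv]

lemma upperDualPeriod_eq_mul_integral_inv {ζ : ℂ} (hζ : 0 ≤ ζ.im) :
    upperDualPeriod ζ = I * (ζ - 1) * ∫ t, (dualRoot ζ t)⁻¹ ∂betaMeasure (1 / 2) (3 / 2) := by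
  rw [upperDualPeriod, integral_inv_dualRoot hζ]
  simp only [dualKernel, div_eq_mul_inv (ζ - 1), integral_const_mul]
  ring

lemma aD_eq_upperDualPeriod {z : ℂ} (hz : 0 ≤ z.im) : aD z = upperDualPeriod ((z + 1) / 2) := by
  have euler := hypergeom_eq_integral_betaMeasure (b := 1 / 2) (c := 2) one_half_pos
    (by norm_num) (1 / 2) ((1 - z) / 2)
  push_cast at euler
  rw [aD, euler, upperDualPeriod_eq_mul_integral_inv (im_add_one_div_two_nonneg hz),
    show (z + 1) / 2 - 1 = (z - 1) / 2 by ring, show (2 - 1 / 2 : ℝ) = 3 / 2 by norm_num]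
  congr 1
  refine integral_congr_ae (ae_betaMeasure_of_forall_mem_Ioo fun t ht => ?_)
  simp only
  rw [cpow_neg, one_div 2, cpow_inv_two_eq_upperSqrt, dualRoot]
  · congr 3
    ring
  · simpa [neg_div] using mul_nonneg (div_nonneg hz zero_le_two) ht.1.le

lemma upperDualPeriod_zero : upperDualPeriod 0 = -(4 * I / Real.pi) := by
  have pointwise : ∀ᵐ t : ℝ ∂betaMeasure (1 / 2) (3 / 2),
      (dualRoot 0 t)⁻¹ = (((1 - t) ^ (-(1 / 2) : ℝ) : ℝ) : ℂ) :=
    ae_betaMeasure_of_forall_mem_Ioo fun t ht => by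
      have one_sub_nonneg : 0 ≤ 1 - t := (sub_pos.2 ht.2).le
      rw [dualRoot, show 1 + (0 - 1) * (t : ℂ) = ((1 - t : ℝ) : ℂ) by push_cast; ring,
        upperSqrt_ofReal_of_nonneg one_sub_nonneg, Real.rpow_neg one_sub_nonneg,
        Real.sqrt_eq_rpow, ofReal_inv]
  have mean : ∫ t : ℝ, (1 - t) ^ (-(1 / 2) : ℝ) ∂betaMeasure (1 / 2) (3 / 2) = 4 / Real.pi := by
    rw [integral_betaMeasure_comp_one_sub (by norm_num) (by norm_num)
        fun t : ℝ => t ^ (-(1 / 2) : ℝ),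
      integral_rpow_betaMeasure (by norm_num) (by norm_num) (by norm_num),
      show (3 / 2 + -(1 / 2) : ℝ) = 1 by norm_num, beta_one_half,
      beta_comm, beta_half_three_halves]
    ring
  rw [upperDualPeriod_eq_mul_integral_inv le_rfl, integral_congr_ae pointwise,
    integral_complex_ofReal, mean]
  push_cast
  ring

end DualPeriod

section Conjugation

lemma a_conj {z : ℂ} (hz : z.im ≠ 0) : a (conj z) = conj (a z) := by
  have add_one_ne_zero : z + 1 ≠ 0 := fun h => hz (by simpa using congrArg Complex.im h)
  have z_ne : z ≠ -1 := fun h => add_one_ne_zero (by rw [h, neg_add_cancel])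
  have conj_ne : conj z ≠ -1 := fun h => z_ne (by simpa using congrArg conj h)
  have arg_ne : ((z + 1) / 2).arg ≠ Real.pi := fun h => hz (by simpa using (arg_eq_pi_iff.1 h).2)
  have inv_im_ne : (2 / (z + 1)).im ≠ 0 := by simp [div_im, hz, add_one_ne_zero]
  have root_conj := conj_cpow _ (1 / 2 : ℂ) arg_ne
  have hypergeom_conj := hypergeom_conj (a := -1 / 2) one_half_pos one_half_lt_one inv_im_ne
  push_cast at hypergeom_conj
  rw [a, a, if_neg z_ne, if_neg conj_ne]
  simp only [map_mul, map_div₀, map_add, map_one, map_ofNat] at root_conj hypergeom_conj ⊢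
  rw [root_conj, hypergeom_conj]

lemma aD_conj {z : ℂ} (hz : z.im ≠ 0) : aD (conj z) = -conj (aD z) := by
  have hypergeom_conj := hypergeom_conj (a := 1 / 2) (b := 1 / 2) (c := 2) (x := (1 - z) / 2)
    one_half_pos (by norm_num) (by simpa using hz)
  push_cast at hypergeom_conj
  simp only [aD, map_mul, map_div₀, map_sub, map_one, map_ofNat, conj_I] at hypergeom_conj ⊢
  rw [hypergeom_conj]
  ring

end Conjugation

section PeriodForm

/-- The hermitian form `Im (conj u * v)` on the plane of period vectors `(u, v) = (a, a_D)`. -/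
def periodForm (u v : ℂ) : ℝ := (conj u * v).im

lemma periodForm_eq (u v : ℂ) : periodForm u v = u.re * v.im - u.im * v.re := by
  simp only [periodForm, mul_im, conj_re, conj_im]
  ring

lemma periodForm_conj (u v : ℂ) : periodForm (conj u) (-conj v) = periodForm u v := by
  simp [periodForm_eq]

lemma div_im_eq_periodForm_div_normSq (u v : ℂ) : (v / u).im = periodForm u v / normSq u := by
  rw [div_im, periodForm_eq]
  ring

lemma periodForm_eq_zero {p q : ℝ} (hpq : p ≠ 0 ∨ q ≠ 0) {u v : ℂ} (h : p * u + q * v = 0) :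
    periodForm u v = 0 := by
  have re_eq : p * u.re + q * v.re = 0 := by simpa using congrArg Complex.re h
  have im_eq : p * u.im + q * v.im = 0 := by simpa using congrArg Complex.im h
  rw [periodForm_eq]
  rcases hpq with hp | hq
  · refine (mul_eq_zero.1 ?_).resolve_left hp
    linear_combination v.im * re_eq - v.re * im_eq
  · refine (mul_eq_zero.1 ?_).resolve_left hq
    linear_combination u.re * im_eq - u.im * re_eq

lemma one_lt_of_periodForm_pos {p q c : ℝ} (hpq : p ≠ 0 ∨ q ≠ 0) (hc : 0 < c) {u v u₀ v₀ : ℂ}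
    (h : p * u + q * v = c * (p * u₀ + q * v₀)) (pos : 0 < periodForm u v)
    (null : periodForm u₀ v₀ = 0) (sub_pos : 0 < periodForm (u - u₀) (v - v₀)) : 1 < c := by
  have residual_null : periodForm (u - c * u₀) (v - c * v₀) = 0 :=
    periodForm_eq_zero hpq (by linear_combination h)
  have scaling : (c - 1) * periodForm u v = c * periodForm (u - u₀) (v - v₀) := by
    simp only [periodForm_eq, sub_re, sub_im, re_ofReal_mul, im_ofReal_mul] at null residual_null ⊢
    linear_combination (c ^ 2 - c) * null - residual_null
  have := pos_of_mul_pos_left (scaling ▸ mul_pos hc sub_pos) pos.le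
  linarith

lemma periodForm_sub_le_periodForm_sub_conj {u v u₀ v₀ : ℂ} (hu : 0 ≤ u.im) (hu₀ : 0 ≤ u₀.im)
    (hv : v.re ≤ 0) (hv₀ : v₀.re ≤ 0) :
    periodForm (u - u₀) (v - v₀) ≤ periodForm (u - conj u₀) (v - -conj v₀) := by
  simp only [periodForm_eq, sub_re, sub_im, neg_re, neg_im, conj_re, conj_im]
  linarith [mul_nonpos_of_nonneg_of_nonpos hu hv₀, mul_nonpos_of_nonneg_of_nonpos hu₀ hv]

end PeriodForm

section Difference

lemma upperSqrt_add_ne_zero {w w₀ : ℂ} (h : w ≠ 0 ∨ w₀ ≠ 0) :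
    upperSqrt w + upperSqrt w₀ ≠ 0 := by
  intro sum_eq
  have re_sum := congrArg Complex.re sum_eq
  have im_sum := congrArg Complex.im sum_eq
  simp only [add_re, add_im, zero_re, zero_im] at re_sum im_sum
  have re_nonneg := upperSqrt_re_nonneg w
  have im_nonneg := upperSqrt_im_nonneg w
  have re_nonneg₀ := upperSqrt_re_nonneg w₀
  have im_nonneg₀ := upperSqrt_im_nonneg w₀
  rcases h with h | h <;> rcases mem_slitPlane_or_neg_mem_slitPlane h with h | h
  · linarith [upperSqrt_re_pos h]
  · linarith [upperSqrt_im_pos h]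
  · linarith [upperSqrt_re_pos h]
  · linarith [upperSqrt_im_pos h]

/-- The difference quotient of `upperSqrt` on the closed upper half plane. At `w = w₀ = 0` it takes
the value `0⁻¹ = 0`. -/
def sqrtSlope (w w₀ : ℂ) : ℂ := (upperSqrt w + upperSqrt w₀)⁻¹

lemma upperSqrt_sub_upperSqrt {w w₀ : ℂ} (hw : 0 ≤ w.im) (hw₀ : 0 ≤ w₀.im) :
    upperSqrt w - upperSqrt w₀ = (w - w₀) * sqrtSlope w w₀ := by
  by_cases h : w ≠ 0 ∨ w₀ ≠ 0
  · rw [sqrtSlope, eq_mul_inv_iff_mul_eq₀ (upperSqrt_add_ne_zero h)]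
    linear_combination upperSqrt_sq hw - upperSqrt_sq hw₀
  · push Not at h
    simp [h.1, h.2]

lemma sqrtSlope_comm (w w₀ : ℂ) : sqrtSlope w w₀ = sqrtSlope w₀ w := by
  rw [sqrtSlope, sqrtSlope, add_comm]

lemma sqrtSlope_re_nonneg (w w₀ : ℂ) : 0 ≤ (sqrtSlope w w₀).re := by
  rw [sqrtSlope, inv_re, add_re]
  exact div_nonneg (add_nonneg (upperSqrt_re_nonneg w) (upperSqrt_re_nonneg w₀)) (normSq_nonneg _)

lemma sqrtSlope_im_nonpos (w w₀ : ℂ) : (sqrtSlope w w₀).im ≤ 0 := by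
  rw [sqrtSlope, inv_im, add_im, neg_div, neg_nonpos]
  exact div_nonneg (add_nonneg (upperSqrt_im_nonneg w) (upperSqrt_im_nonneg w₀)) (normSq_nonneg _)

lemma sqrtSlope_re_pos {w : ℂ} (hw : w ∈ slitPlane) (w₀ : ℂ) : 0 < (sqrtSlope w w₀).re := by
  rw [sqrtSlope, inv_re, add_re]
  exact div_pos (add_pos_of_pos_of_nonneg (upperSqrt_re_pos hw) (upperSqrt_re_nonneg w₀))
    (normSq_pos.2 (upperSqrt_add_ne_zero (.inl (slitPlane_ne_zero hw))))

lemma sqrtSlope_im_neg {w : ℂ} (hw : -w ∈ slitPlane) (w₀ : ℂ) : (sqrtSlope w w₀).im < 0 := by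
  rw [sqrtSlope, inv_im, add_im, neg_div, neg_lt_zero]
  exact div_pos (add_pos_of_pos_of_nonneg (upperSqrt_im_pos hw) (upperSqrt_im_nonneg w₀))
    (normSq_pos.2 (upperSqrt_add_ne_zero (.inl (neg_ne_zero.1 (slitPlane_ne_zero hw)))))

/-- The difference quotient of `upperPeriod`. -/
def periodSlope (ζ ζ₀ : ℂ) : ℂ := ∫ t : ℝ, sqrtSlope (ζ - t) (ζ₀ - t) ∂arcsineMeasure

/-- The difference quotient of `upperDualPeriod / (2 * I)`. -/
def dualPeriodSlope (ζ ζ₀ : ℂ) : ℂ :=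
  ∫ t : ℝ, sqrtSlope (1 + (ζ - 1) * t) (1 + (ζ₀ - 1) * t) ∂arcsineMeasure

lemma upperPeriod_sub {ζ ζ₀ : ℂ} (hζ : 0 ≤ ζ.im) (hζ₀ : 0 ≤ ζ₀.im) :
    upperPeriod ζ - upperPeriod ζ₀ = (ζ - ζ₀) * periodSlope ζ ζ₀ := by
  rw [upperPeriod, upperPeriod, periodSlope, ← integral_const_mul,
    ← integral_sub (integrable_upperSqrt_sub ζ) (integrable_upperSqrt_sub ζ₀)]
  refine integral_congr_ae (.of_forall fun t => ?_)
  simp only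
  rw [upperSqrt_sub_upperSqrt (by simpa using hζ) (by simpa using hζ₀), sub_sub_sub_cancel_right]

lemma mul_dualKernel {ζ : ℂ} (hζ : 0 ≤ ζ.im) {t : ℝ} (ht : 0 ≤ t) :
    t * dualKernel ζ t = dualRoot ζ t - 1 := by
  rw [dualKernel, mul_div_assoc', div_eq_iff (one_add_dualRoot_ne_zero ζ t)]
  linear_combination -dualRoot_sq hζ ht

lemma dualKernel_sub {ζ ζ₀ : ℂ} (hζ : 0 ≤ ζ.im) (hζ₀ : 0 ≤ ζ₀.im) {t : ℝ} (ht : 0 < t) :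
    dualKernel ζ t - dualKernel ζ₀ t =
      (ζ - ζ₀) * sqrtSlope (1 + (ζ - 1) * t) (1 + (ζ₀ - 1) * t) := by
  have root_sub := upperSqrt_sub_upperSqrt (w := 1 + (ζ - 1) * t) (w₀ := 1 + (ζ₀ - 1) * t)
    (by simpa using mul_nonneg hζ ht.le) (by simpa using mul_nonneg hζ₀ ht.le)
  refine mul_left_cancel₀ (ofReal_ne_zero.2 ht.ne') ?_
  rw [mul_sub, mul_dualKernel hζ ht.le, mul_dualKernel hζ₀ ht.le, sub_sub_sub_cancel_right,
    dualRoot, dualRoot, root_sub]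
  ring

lemma upperDualPeriod_sub {ζ ζ₀ : ℂ} (hζ : 0 ≤ ζ.im) (hζ₀ : 0 ≤ ζ₀.im) :
    upperDualPeriod ζ - upperDualPeriod ζ₀ = 2 * I * ((ζ - ζ₀) * dualPeriodSlope ζ ζ₀) := by
  rw [upperDualPeriod, upperDualPeriod, dualPeriodSlope, ← mul_sub, ← integral_const_mul,
    ← integral_sub (integrable_dualKernel ζ) (integrable_dualKernel ζ₀)]
  congr 1
  exact integral_congr_ae (ae_betaMeasure_of_forall_mem_Ioo fun t ht => dualKernel_sub hζ hζ₀ ht.1)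

lemma periodForm_sub_eq {ζ ζ₀ : ℂ} (hζ : 0 ≤ ζ.im) (hζ₀ : 0 ≤ ζ₀.im) :
    periodForm (upperPeriod ζ - upperPeriod ζ₀) (upperDualPeriod ζ - upperDualPeriod ζ₀) =
      2 * normSq (ζ - ζ₀) * (conj (periodSlope ζ ζ₀) * dualPeriodSlope ζ ζ₀).re := by
  rw [upperPeriod_sub hζ hζ₀, upperDualPeriod_sub hζ hζ₀, periodForm, map_mul,
    show conj (ζ - ζ₀) * conj (periodSlope ζ ζ₀) * (2 * I * ((ζ - ζ₀) * dualPeriodSlope ζ ζ₀)) =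
      (2 * normSq (ζ - ζ₀) : ℝ) * (I * (conj (periodSlope ζ ζ₀) * dualPeriodSlope ζ ζ₀)) by
        push_cast [normSq_eq_conj_mul_self]; ring, im_ofReal_mul, I_mul_im]

end Difference

section ComplexIntegral

variable {X : Type*} [MeasurableSpace X] {μ : Measure X} {f : X → ℂ}

lemma re_integral_nonneg (hf : Integrable f μ) (h : ∀ᵐ x ∂μ, 0 ≤ (f x).re) :
    0 ≤ (∫ x, f x ∂μ).re :=
  (integral_nonneg_of_ae h).trans_eq (integral_re hf)

lemma im_integral_nonneg (hf : Integrable f μ) (h : ∀ᵐ x ∂μ, 0 ≤ (f x).im) :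
    0 ≤ (∫ x, f x ∂μ).im :=
  (integral_nonneg_of_ae h).trans_eq (integral_im hf)

lemma im_integral_nonpos (hf : Integrable f μ) (h : ∀ᵐ x ∂μ, (f x).im ≤ 0) :
    (∫ x, f x ∂μ).im ≤ 0 :=
  (integral_im hf).symm.trans_le (integral_nonpos_of_ae h)

variable {α β : ℝ} {g : ℝ → ℂ}

lemma re_integral_betaMeasure_pos (hα : 0 < α) (hβ : 0 < β) (hg : Continuous g)
    (nonneg : ∀ t ∈ Icc (0 : ℝ) 1, 0 ≤ (g t).re) {t₀ : ℝ} (ht₀ : t₀ ∈ Icc (0 : ℝ) 1)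
    (pos : 0 < (g t₀).re) : 0 < (∫ t, g t ∂betaMeasure α β).re :=
  (integral_betaMeasure_pos hα hβ (continuous_re.comp hg) nonneg ht₀ pos).trans_eq
    (integral_re (integrable_betaMeasure_of_continuous hα hβ hg))

lemma im_integral_betaMeasure_neg (hα : 0 < α) (hβ : 0 < β) (hg : Continuous g)
    (nonpos : ∀ t ∈ Icc (0 : ℝ) 1, (g t).im ≤ 0) {t₀ : ℝ} (ht₀ : t₀ ∈ Icc (0 : ℝ) 1)
    (neg : (g t₀).im < 0) : (∫ t, g t ∂betaMeasure α β).im < 0 := by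
  have pos := re_integral_betaMeasure_pos hα hβ (g := fun t => I * g t) (by fun_prop)
    (fun t ht => by simpa using nonpos t ht) ht₀ (by simpa using neg)
  rw [integral_const_mul, I_mul_re] at pos
  exact neg_pos.1 pos

end ComplexIntegral

section Slopes

variable {ζ ζ₀ : ℂ}

lemma continuous_sqrtSlope_sub (hne : ζ ≠ ζ₀) :
    Continuous fun t : ℝ => sqrtSlope (ζ - t) (ζ₀ - t) := by
  refine ((continuous_upperSqrt.comp (by fun_prop)).add
    (continuous_upperSqrt.comp (by fun_prop))).inv₀ fun t => upperSqrt_add_ne_zero ?_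
  by_contra! h
  exact hne (sub_left_injective (h.1.trans h.2.symm))

lemma continuous_sqrtSlope_dual (hne : ζ ≠ ζ₀) :
    Continuous fun t : ℝ => sqrtSlope (1 + (ζ - 1) * t) (1 + (ζ₀ - 1) * t) := by
  refine ((continuous_upperSqrt.comp (by fun_prop)).add
    (continuous_upperSqrt.comp (by fun_prop))).inv₀ fun t => upperSqrt_add_ne_zero ?_
  by_contra! h
  have mul_eq : (ζ - ζ₀) * t = 0 := by linear_combination h.1 - h.2
  have t_eq := (mul_eq_zero.1 mul_eq).resolve_left (sub_ne_zero.2 hne)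
  simp [t_eq] at h

lemma periodSlope_comm (ζ ζ₀ : ℂ) : periodSlope ζ ζ₀ = periodSlope ζ₀ ζ := by
  simp only [periodSlope, sqrtSlope_comm]

lemma dualPeriodSlope_comm (ζ ζ₀ : ℂ) : dualPeriodSlope ζ ζ₀ = dualPeriodSlope ζ₀ ζ := by
  simp only [dualPeriodSlope, sqrtSlope_comm]

lemma periodSlope_re_nonneg (hne : ζ ≠ ζ₀) : 0 ≤ (periodSlope ζ ζ₀).re :=
  re_integral_nonneg (integrable_betaMeasure_of_continuous one_half_pos one_half_pos
    (continuous_sqrtSlope_sub hne)) (.of_forall fun _ => sqrtSlope_re_nonneg _ _)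

lemma periodSlope_im_nonpos (hne : ζ ≠ ζ₀) : (periodSlope ζ ζ₀).im ≤ 0 :=
  im_integral_nonpos (integrable_betaMeasure_of_continuous one_half_pos one_half_pos
    (continuous_sqrtSlope_sub hne)) (.of_forall fun _ => sqrtSlope_im_nonpos _ _)

lemma periodSlope_re_pos (hne : ζ ≠ ζ₀) (hζ : ζ ∈ slitPlane) : 0 < (periodSlope ζ ζ₀).re :=
  re_integral_betaMeasure_pos one_half_pos one_half_pos (continuous_sqrtSlope_sub hne)
    (fun _ _ => sqrtSlope_re_nonneg _ _) (left_mem_Icc.2 zero_le_one)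
    (sqrtSlope_re_pos (by simpa using hζ) _)

lemma periodSlope_im_neg (hne : ζ ≠ ζ₀) (hζ : 1 - ζ ∈ slitPlane) : (periodSlope ζ ζ₀).im < 0 :=
  im_integral_betaMeasure_neg one_half_pos one_half_pos (continuous_sqrtSlope_sub hne)
    (fun _ _ => sqrtSlope_im_nonpos _ _) (right_mem_Icc.2 zero_le_one)
    (sqrtSlope_im_neg (by simpa using hζ) _)

lemma dualPeriodSlope_re_pos (hne : ζ ≠ ζ₀) : 0 < (dualPeriodSlope ζ ζ₀).re :=
  re_integral_betaMeasure_pos one_half_pos one_half_pos (continuous_sqrtSlope_dual hne)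
    (fun _ _ => sqrtSlope_re_nonneg _ _) (left_mem_Icc.2 zero_le_one)
    (sqrtSlope_re_pos (by simp) _)

lemma dualPeriodSlope_im_nonpos (hne : ζ ≠ ζ₀) : (dualPeriodSlope ζ ζ₀).im ≤ 0 :=
  im_integral_nonpos (integrable_betaMeasure_of_continuous one_half_pos one_half_pos
    (continuous_sqrtSlope_dual hne)) (.of_forall fun _ => sqrtSlope_im_nonpos _ _)

lemma dualPeriodSlope_im_neg (hne : ζ ≠ ζ₀) (hζ : -ζ ∈ slitPlane) :
    (dualPeriodSlope ζ ζ₀).im < 0 :=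
  im_integral_betaMeasure_neg one_half_pos one_half_pos (continuous_sqrtSlope_dual hne)
    (fun _ _ => sqrtSlope_im_nonpos _ _) (right_mem_Icc.2 zero_le_one)
    (sqrtSlope_im_neg (by simpa using hζ) _)

lemma conj_periodSlope_mul_dualPeriodSlope_re_pos (hne : ζ ≠ ζ₀) :
    0 < (conj (periodSlope ζ ζ₀) * dualPeriodSlope ζ ζ₀).re := by
  wlog ζ_ne_zero : ζ ≠ 0 generalizing ζ ζ₀
  · rw [periodSlope_comm, dualPeriodSlope_comm]
    exact this hne.symm fun h => hne ((not_not.1 ζ_ne_zero).trans h.symm)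
  rw [mul_re, conj_re, conj_im, neg_mul, sub_neg_eq_add]
  by_cases hζ : ζ ∈ slitPlane
  · exact add_pos_of_pos_of_nonneg
      (mul_pos (periodSlope_re_pos hne hζ) (dualPeriodSlope_re_pos hne))
      (mul_nonneg_of_nonpos_of_nonpos (periodSlope_im_nonpos hne) (dualPeriodSlope_im_nonpos hne))
  · have neg_mem := (mem_slitPlane_or_neg_mem_slitPlane ζ_ne_zero).resolve_left hζ
    have one_sub_mem : 1 - ζ ∈ slitPlane := by
      rcases neg_mem with h | h
      · exact .inl (by rw [neg_re] at h; rw [sub_re, one_re]; linarith)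
      · exact .inr (by simpa using h)
    exact add_pos_of_nonneg_of_pos
      (mul_nonneg (periodSlope_re_nonneg hne) (dualPeriodSlope_re_pos hne).le)
      (mul_pos_of_neg_of_neg (periodSlope_im_neg hne one_sub_mem)
        (dualPeriodSlope_im_neg hne neg_mem))

lemma periodForm_sub_pos (hζ : 0 ≤ ζ.im) (hζ₀ : 0 ≤ ζ₀.im) (hne : ζ ≠ ζ₀) :
    0 < periodForm (upperPeriod ζ - upperPeriod ζ₀) (upperDualPeriod ζ - upperDualPeriod ζ₀) := by
  rw [periodForm_sub_eq hζ hζ₀]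
  exact mul_pos (mul_pos two_pos (normSq_pos.2 (sub_ne_zero.2 hne)))
    (conj_periodSlope_mul_dualPeriodSlope_re_pos hne)

end Slopes

section Bounds

variable {ζ : ℂ}

lemma upperPeriod_re_nonneg (ζ : ℂ) : 0 ≤ (upperPeriod ζ).re :=
  re_integral_nonneg (integrable_upperSqrt_sub ζ) (.of_forall fun _ => upperSqrt_re_nonneg _)

lemma upperPeriod_im_nonneg (ζ : ℂ) : 0 ≤ (upperPeriod ζ).im :=
  im_integral_nonneg (integrable_upperSqrt_sub ζ) (.of_forall fun _ => upperSqrt_im_nonneg _)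

lemma upperPeriod_re_pos (hζ : ζ ∈ slitPlane) : 0 < (upperPeriod ζ).re :=
  re_integral_betaMeasure_pos one_half_pos one_half_pos
    (continuous_upperSqrt_sub.comp (Continuous.prodMk_right ζ))
    (fun _ _ => upperSqrt_re_nonneg _) (left_mem_Icc.2 zero_le_one)
    (upperSqrt_re_pos (by simpa using hζ))

lemma upperDualPeriod_re (ζ : ℂ) :
    (upperDualPeriod ζ).re = -(2 * (∫ t, dualKernel ζ t ∂arcsineMeasure).im) := by
  simp [upperDualPeriod]

lemma upperDualPeriod_im (ζ : ℂ) :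
    (upperDualPeriod ζ).im = 2 * (∫ t, dualKernel ζ t ∂arcsineMeasure).re := by
  simp [upperDualPeriod]

lemma mul_dualKernel_re (hζ : 0 ≤ ζ.im) {t : ℝ} (ht : 0 ≤ t) :
    t * (dualKernel ζ t).re = (dualRoot ζ t).re - 1 := by
  rw [← re_ofReal_mul, mul_dualKernel hζ ht, sub_re, one_re]

lemma mul_dualKernel_im (hζ : 0 ≤ ζ.im) {t : ℝ} (ht : 0 ≤ t) :
    t * (dualKernel ζ t).im = (dualRoot ζ t).im := by
  rw [← im_ofReal_mul, mul_dualKernel hζ ht, sub_im, one_im, sub_zero]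

lemma dualKernel_im_nonneg (hζ : 0 ≤ ζ.im) {t : ℝ} (ht : 0 < t) : 0 ≤ (dualKernel ζ t).im :=
  nonneg_of_mul_nonneg_right
    (mul_dualKernel_im hζ ht.le ▸ dualRoot_im_nonneg ζ t) ht

lemma upperDualPeriod_re_nonpos (hζ : 0 ≤ ζ.im) : (upperDualPeriod ζ).re ≤ 0 := by
  rw [upperDualPeriod_re]
  linarith [im_integral_nonneg (integrable_dualKernel ζ)
    (ae_betaMeasure_of_forall_mem_Ioo fun t ht => dualKernel_im_nonneg hζ ht.1)]

lemma periodForm_nonneg_of_upperDualPeriod_im_nonneg (hζ : 0 ≤ ζ.im)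
    (h : 0 ≤ (upperDualPeriod ζ).im) : 0 ≤ periodForm (upperPeriod ζ) (upperDualPeriod ζ) := by
  rw [periodForm_eq, sub_nonneg]
  exact (mul_nonpos_of_nonneg_of_nonpos (upperPeriod_im_nonneg ζ)
    (upperDualPeriod_re_nonpos hζ)).trans (mul_nonneg (upperPeriod_re_nonneg ζ) h)

lemma dualKernel_re_nonneg (hζ : 0 ≤ ζ.im) (hre : 1 ≤ ζ.re) (t : ℝ) :
    0 ≤ (dualKernel ζ t).re := by
  have re_nonneg := dualRoot_re_nonneg ζ t
  have im_nonneg := dualRoot_im_nonneg ζ t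
  rw [dualKernel, div_re, ← add_div]
  simp only [sub_re, sub_im, add_re, add_im, one_re, one_im, sub_zero, zero_add]
  exact div_nonneg (add_nonneg (mul_nonneg (by linarith) (by linarith))
    (mul_nonneg hζ im_nonneg)) (normSq_nonneg _)

lemma upperDualPeriod_im_nonneg_of_one_le_re (hζ : 0 ≤ ζ.im) (hre : 1 ≤ ζ.re) :
    0 ≤ (upperDualPeriod ζ).im := by
  rw [upperDualPeriod_im]
  exact mul_nonneg zero_le_two (re_integral_nonneg (integrable_dualKernel ζ)
    (.of_forall (dualKernel_re_nonneg hζ hre)))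

lemma upperSqrt_re_sq_sub_im_sq {w : ℂ} (hw : 0 ≤ w.im) :
    (upperSqrt w).re ^ 2 - (upperSqrt w).im ^ 2 = w.re := by
  have := congrArg Complex.re (upperSqrt_sq hw)
  rwa [sq, mul_re, ← sq, ← sq] at this

lemma two_mul_upperSqrt_re_mul_im {w : ℂ} (hw : 0 ≤ w.im) :
    2 * ((upperSqrt w).re * (upperSqrt w).im) = w.im := by
  have := congrArg Complex.im (upperSqrt_sq hw)
  rwa [sq, mul_im, mul_comm (upperSqrt w).im, ← two_mul] at this

lemma dualRoot_re_sq_sub_im_sq (hζ : 0 ≤ ζ.im) {t : ℝ} (ht : 0 ≤ t) :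
    (dualRoot ζ t).re ^ 2 - (dualRoot ζ t).im ^ 2 = 1 + (ζ.re - 1) * t := by
  simpa [dualRoot] using
    upperSqrt_re_sq_sub_im_sq (w := 1 + (ζ - 1) * t) (by simpa using mul_nonneg hζ ht)

lemma two_mul_dualRoot_re_mul_im (hζ : 0 ≤ ζ.im) {t : ℝ} (ht : 0 ≤ t) :
    2 * ((dualRoot ζ t).re * (dualRoot ζ t).im) = ζ.im * t := by
  simpa [dualRoot] using
    two_mul_upperSqrt_re_mul_im (w := 1 + (ζ - 1) * t) (by simpa using mul_nonneg hζ ht)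

lemma two_mul_sub_one_le_dualKernel_re (hre : 0 ≤ ζ.re) (him : 16 ≤ ζ.im) {t : ℝ}
    (ht : t ∈ Ioo (0 : ℝ) 1) : 2 * t - 1 ≤ (dualKernel ζ t).re := by
  have hζ : 0 ≤ ζ.im := by linarith
  obtain ⟨t_pos, t_lt_one⟩ := ht
  have re_nonneg := dualRoot_re_nonneg ζ t
  have im_nonneg := dualRoot_im_nonneg ζ t
  have sq_sub_sq := dualRoot_re_sq_sub_im_sq hζ t_pos.le
  have two_mul := two_mul_dualRoot_re_mul_im hζ t_pos.le
  refine le_of_mul_le_mul_left ?_ t_pos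
  rw [mul_dualKernel_re hζ t_pos.le]
  generalize (dualRoot ζ t).re = X at *
  generalize (dualRoot ζ t).im = Y at *
  by_contra! X_lt
  have X_le_two : X ≤ 2 := by nlinarith
  have le_Y : 4 * t ≤ Y := by nlinarith
  have X_sq_lt : X ^ 2 < (1 - t + 2 * t ^ 2) ^ 2 :=
    pow_lt_pow_left₀ (by linarith) re_nonneg (by simp)
  have le_X_sq : 1 - t + 16 * t ^ 2 ≤ X ^ 2 := by nlinarith
  nlinarith [pow_le_pow_of_le_one t_pos.le t_lt_one.le (show 2 ≤ 4 by norm_num), pow_pos t_pos 3]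

lemma integral_two_mul_sub_one_arcsineMeasure : ∫ t : ℝ, (2 * t - 1) ∂arcsineMeasure = 0 := by
  have reflect := integral_betaMeasure_comp_one_sub one_half_pos one_half_pos
    fun t : ℝ => 2 * t - 1
  rw [show (fun t : ℝ => 2 * (1 - t) - 1) = fun t => -(2 * t - 1) by funext t; ring,
    integral_neg] at reflect
  exact self_eq_neg.1 reflect.symm

lemma upperDualPeriod_im_nonneg_of_le_im (hre : 0 ≤ ζ.re) (him : 16 ≤ ζ.im) :
    0 ≤ (upperDualPeriod ζ).im := by
  rw [upperDualPeriod_im]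
  refine mul_nonneg zero_le_two ?_
  calc (0 : ℝ) = ∫ t : ℝ, (2 * t - 1) ∂arcsineMeasure :=
        integral_two_mul_sub_one_arcsineMeasure.symm
    _ ≤ ∫ t, (dualKernel ζ t).re ∂arcsineMeasure :=
        integral_mono_ae
          (integrable_betaMeasure_of_continuous one_half_pos one_half_pos (by fun_prop))
          (integrable_dualKernel ζ).re
          (ae_betaMeasure_of_forall_mem_Ioo fun t => two_mul_sub_one_le_dualKernel_re hre him)
    _ = (∫ t, dualKernel ζ t ∂arcsineMeasure).re := integral_re (integrable_dualKernel ζ)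

lemma upperSqrt_sub_one_sub_re_le_dualKernel_im (hζ : 0 ≤ ζ.im) (hre : ζ.re ≤ 0) {t : ℝ}
    (ht : t ∈ Ioo (0 : ℝ) 1) : (upperSqrt (ζ - (1 - t : ℝ))).re ≤ (dualKernel ζ t).im := by
  obtain ⟨t_pos, t_lt_one⟩ := ht
  have him : 0 ≤ (ζ - (1 - t : ℝ)).im := by rwa [sub_im, ofReal_im, sub_zero]
  have root_sq_sub_sq := upperSqrt_re_sq_sub_im_sq him
  have root_two_mul := two_mul_upperSqrt_re_mul_im him
  have A_nonneg := upperSqrt_re_nonneg (ζ - (1 - t : ℝ))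
  have B_nonneg := upperSqrt_im_nonneg (ζ - (1 - t : ℝ))
  have dual_sq_sub_sq := dualRoot_re_sq_sub_im_sq hζ t_pos.le
  have dual_two_mul := two_mul_dualRoot_re_mul_im hζ t_pos.le
  have Y_nonneg := dualRoot_im_nonneg ζ t
  rw [sub_re, ofReal_re] at root_sq_sub_sq
  rw [sub_im, ofReal_im, sub_zero] at root_two_mul
  refine le_of_mul_le_mul_left ?_ t_pos
  rw [mul_dualKernel_im hζ t_pos.le]
  generalize (upperSqrt (ζ - (1 - t : ℝ))).re = A at *
  generalize (upperSqrt (ζ - (1 - t : ℝ))).im = B at *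
  generalize (dualRoot ζ t).re = X at *
  generalize (dualRoot ζ t).im = Y at *
  have mul_eq : X * Y = t * (A * B) := by linear_combination (dual_two_mul - t * root_two_mul) / 2
  have B_pos : 0 < B := by nlinarith
  have X_le_B : X ≤ B := by
    by_contra! B_lt_X
    have A_lt_Y : A < Y := lt_of_pow_lt_pow_left₀ 2 Y_nonneg (by nlinarith)
    nlinarith [mul_lt_mul'' B_lt_X A_lt_Y B_nonneg A_nonneg, mul_nonneg A_nonneg B_nonneg]
  refine le_of_mul_le_mul_left ?_ B_pos
  calc B * (t * A) = X * Y := by rw [mul_eq]; ring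
    _ ≤ B * Y := mul_le_mul_of_nonneg_right X_le_B Y_nonneg

lemma two_mul_upperPeriod_re_le (hζ : 0 ≤ ζ.im) (hre : ζ.re ≤ 0) :
    2 * (upperPeriod ζ).re ≤ -(upperDualPeriod ζ).re := by
  rw [upperDualPeriod_re, neg_neg]
  refine mul_le_mul_of_nonneg_left ?_ zero_le_two
  have integrable_reflected :
      Integrable (fun t : ℝ => upperSqrt (ζ - (1 - t : ℝ))) arcsineMeasure :=
    integrable_betaMeasure_of_continuous one_half_pos one_half_pos
      (continuous_upperSqrt.comp (by fun_prop))
  calc (upperPeriod ζ).re = (∫ t : ℝ, upperSqrt (ζ - (1 - t : ℝ)) ∂arcsineMeasure).re :=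
        congrArg Complex.re (integral_betaMeasure_comp_one_sub one_half_pos one_half_pos
          fun t : ℝ => upperSqrt (ζ - t)).symm
    _ = ∫ t : ℝ, (upperSqrt (ζ - (1 - t : ℝ))).re ∂arcsineMeasure :=
        (integral_re integrable_reflected).symm
    _ ≤ ∫ t, (dualKernel ζ t).im ∂arcsineMeasure :=
        integral_mono_ae integrable_reflected.re (integrable_dualKernel ζ).im
          (ae_betaMeasure_of_forall_mem_Ioo fun t =>
            upperSqrt_sub_one_sub_re_le_dualKernel_im hζ hre)
    _ = (∫ t, dualKernel ζ t ∂arcsineMeasure).im := integral_im (integrable_dualKernel ζ)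

lemma periodForm_nonneg_of_re_nonpos (hζ : 0 ≤ ζ.im) (hre : ζ.re ≤ 0) :
    0 ≤ periodForm (upperPeriod ζ) (upperDualPeriod ζ) := by
  have upperPeriod_zero : upperPeriod 0 = (2 / Real.pi : ℝ) * I := by
    rw [upperPeriod_zero]; push_cast; ring
  have upperDualPeriod_zero : upperDualPeriod 0 = (-(2 * (2 / Real.pi)) : ℝ) * I := by
    rw [upperDualPeriod_zero]; push_cast; ring
  rcases eq_or_ne ζ 0 with rfl | hne
  · simp [periodForm_eq, upperPeriod_zero, upperDualPeriod_zero]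
  · have sub_pos := periodForm_sub_pos hζ zero_im.ge hne
    have re_le := two_mul_upperPeriod_re_le hζ hre
    have period_zero_pos : 0 < 2 / Real.pi := div_pos two_pos Real.pi_pos
    rw [upperPeriod_zero, upperDualPeriod_zero, periodForm_eq] at sub_pos
    generalize 2 / Real.pi = b at *
    simp only [sub_re, sub_im, re_ofReal_mul, im_ofReal_mul, I_re, I_im, mul_zero, mul_one,
      sub_zero] at sub_pos
    rw [periodForm_eq]
    linarith [mul_le_mul_of_nonneg_left re_le period_zero_pos.le]

end Bounds

section Curve

/-- The point `(z + 1) / 2` reflected into the closed upper half plane, the coordinate in which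
`upperPeriod` and `upperDualPeriod` are the periods at `z`, up to complex conjugation. -/
def fold (z : ℂ) : ℂ := ⟨(z.re + 1) / 2, |z.im| / 2⟩

lemma fold_im_nonneg (z : ℂ) : 0 ≤ (fold z).im := div_nonneg (abs_nonneg _) zero_le_two

lemma fold_of_im_nonneg {z : ℂ} (hz : 0 ≤ z.im) : fold z = (z + 1) / 2 := by
  apply Complex.ext <;> simp [fold, abs_of_nonneg hz]

lemma fold_conj (z : ℂ) : fold (conj z) = fold z := by simp [fold]

lemma continuous_fold : Continuous fold := by
  have : fold = fun z => equivRealProdCLM.symm ((z.re + 1) / 2, |z.im| / 2) := by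
    funext z
    apply Complex.ext <;> simp [fold]
  rw [this]
  fun_prop

lemma periods_of_im_nonneg {z : ℂ} (hz : 0 ≤ z.im) :
    a z = upperPeriod (fold z) ∧ aD z = upperDualPeriod (fold z) := by
  rw [fold_of_im_nonneg hz]
  exact ⟨a_eq_upperPeriod hz, aD_eq_upperDualPeriod hz⟩

lemma periods_of_im_neg {z : ℂ} (hz : z.im < 0) :
    a z = conj (upperPeriod (fold z)) ∧ aD z = -conj (upperDualPeriod (fold z)) := by
  have conj_im_pos : 0 < (conj z).im := by rwa [conj_im, neg_pos]
  obtain ⟨a_conj_eq, aD_conj_eq⟩ := periods_of_im_nonneg conj_im_pos.le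
  rw [fold_conj] at a_conj_eq aD_conj_eq
  rw [← a_conj_eq, ← aD_conj_eq, ← a_conj conj_im_pos.ne', ← aD_conj conj_im_pos.ne', conj_conj]
  exact ⟨rfl, rfl⟩

lemma periodForm_periods (z : ℂ) :
    periodForm (a z) (aD z) = periodForm (upperPeriod (fold z)) (upperDualPeriod (fold z)) := by
  rcases le_or_gt 0 z.im with hz | hz
  · rw [(periods_of_im_nonneg hz).1, (periods_of_im_nonneg hz).2]
  · rw [(periods_of_im_neg hz).1, (periods_of_im_neg hz).2, periodForm_conj]

lemma continuous_periodForm_periods : Continuous fun z => periodForm (a z) (aD z) := by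
  simp_rw [periodForm_periods, periodForm]
  exact continuous_im.comp ((continuous_conj.comp (continuous_upperPeriod.comp continuous_fold)).mul
    (continuous_upperDualPeriod.comp continuous_fold))

lemma mem_marginalCurve_iff {z : ℂ} : z ∈ marginalCurve ↔ periodForm (a z) (aD z) = 0 := by
  rw [marginalCurve, mem_ofPred_eq, div_im_eq_periodForm_div_normSq, div_eq_zero_iff,
    or_iff_left_of_imp]
  intro a_eq_zero
  rw [normSq_eq_zero.1 a_eq_zero, periodForm, map_zero, zero_mul, zero_im]

lemma a_ne_zero_of_notMem_marginalCurve {z : ℂ} (hz : z ∉ marginalCurve) : a z ≠ 0 := by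
  intro a_eq_zero
  refine hz (mem_marginalCurve_iff.2 ?_)
  rw [a_eq_zero, periodForm, map_zero, zero_mul, zero_im]

lemma isBounded_periodForm_neg : Bornology.IsBounded {z | periodForm (a z) (aD z) < 0} := by
  refine (Metric.isBounded_closedBall (x := (0 : ℂ)) (r := 33)).subset fun z form_neg => ?_
  rw [mem_ofPred_eq, periodForm_periods] at form_neg
  have im_nonneg := fold_im_nonneg z
  have re_pos : 0 < (fold z).re := by
    by_contra! h
    exact form_neg.not_ge (periodForm_nonneg_of_re_nonpos im_nonneg h)
  have re_lt_one : (fold z).re < 1 := by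
    by_contra! h
    exact form_neg.not_ge (periodForm_nonneg_of_upperDualPeriod_im_nonneg im_nonneg
      (upperDualPeriod_im_nonneg_of_one_le_re im_nonneg h))
  have im_lt : (fold z).im < 16 := by
    by_contra! h
    exact form_neg.not_ge (periodForm_nonneg_of_upperDualPeriod_im_nonneg im_nonneg
      (upperDualPeriod_im_nonneg_of_le_im re_pos.le h))
  simp only [fold] at re_pos re_lt_one im_lt
  have abs_re_le : |z.re| ≤ 1 := abs_le.2 ⟨by linarith, by linarith⟩
  rw [mem_closedBall_zero_iff]
  linarith [norm_le_abs_re_add_abs_im z]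

lemma periodForm_pos_of_mem_weakRegion {z : ℂ} (hz : z ∈ weakRegion) :
    0 < periodForm (a z) (aD z) := by
  obtain ⟨notMem, not_isBounded⟩ := hz
  by_contra! form_nonpos
  refine not_isBounded (isBounded_periodForm_neg.subset fun w hw => ?_)
  by_contra! form_nonneg
  obtain ⟨v, v_mem, form_eq_zero⟩ := isPreconnected_connectedComponentIn.intermediate_value
    (mem_connectedComponentIn notMem) hw continuous_periodForm_periods.continuousOn
    ⟨form_nonpos, not_lt.1 form_nonneg⟩
  exact connectedComponentIn_subset _ _ v_mem (mem_marginalCurve_iff.2 form_eq_zero)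

lemma periodForm_periods_sub_pos {z z₀ : ℂ} (hne : fold z ≠ fold z₀) :
    0 < periodForm (a z - a z₀) (aD z - aD z₀) := by
  have same_side := periodForm_sub_pos (fold_im_nonneg z) (fold_im_nonneg z₀) hne
  have opposite_sides := same_side.trans_le (periodForm_sub_le_periodForm_sub_conj
    (upperPeriod_im_nonneg _) (upperPeriod_im_nonneg _)
    (upperDualPeriod_re_nonpos (fold_im_nonneg z)) (upperDualPeriod_re_nonpos (fold_im_nonneg z₀)))
  rcases le_or_gt 0 z.im with hz | hz <;> rcases le_or_gt 0 z₀.im with hz₀ | hz₀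
  · rwa [(periods_of_im_nonneg hz).1, (periods_of_im_nonneg hz).2, (periods_of_im_nonneg hz₀).1,
      (periods_of_im_nonneg hz₀).2]
  · rwa [(periods_of_im_nonneg hz).1, (periods_of_im_nonneg hz).2, (periods_of_im_neg hz₀).1,
      (periods_of_im_neg hz₀).2]
  · rw [← periodForm_conj] at opposite_sides
    rw [(periods_of_im_neg hz).1, (periods_of_im_neg hz).2, (periods_of_im_nonneg hz₀).1,
      (periods_of_im_nonneg hz₀).2]
    simpa only [map_sub, map_neg, conj_conj, neg_sub', neg_neg] using opposite_sides
  · rw [← periodForm_conj] at same_side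
    rw [(periods_of_im_neg hz).1, (periods_of_im_neg hz).2, (periods_of_im_neg hz₀).1,
      (periods_of_im_neg hz₀).2]
    simpa only [map_sub, neg_sub'] using same_side

lemma one_lt_of_centralCharge_eq_mul {p q c : ℝ} (hpq : p ≠ 0 ∨ q ≠ 0) (hc : 0 < c) {z₀ z : ℂ}
    (hz₀ : z₀ ∈ marginalCurve) (hz : z ∈ weakRegion)
    (h : centralCharge p q z = c * centralCharge p q z₀) : 1 < c := by
  have form_pos := periodForm_pos_of_mem_weakRegion hz
  have form_zero := mem_marginalCurve_iff.1 hz₀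
  have fold_ne : fold z ≠ fold z₀ := fun fold_eq => by
    rw [periodForm_periods, fold_eq, ← periodForm_periods, form_zero] at form_pos
    exact form_pos.false
  exact one_lt_of_periodForm_pos hpq hc h form_pos form_zero (periodForm_periods_sub_pos fold_ne)

end Curve

section Phase

lemma a_re_nonneg (z : ℂ) : 0 ≤ (a z).re := by
  rcases le_or_gt 0 z.im with hz | hz
  · exact (periods_of_im_nonneg hz).1 ▸ upperPeriod_re_nonneg _
  · rw [(periods_of_im_neg hz).1, conj_re]
    exact upperPeriod_re_nonneg _

lemma a_im_nonneg_of_re_eq_zero {z : ℂ} (hre : (a z).re = 0) : 0 ≤ (a z).im := by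
  rcases le_or_gt 0 z.im with hz | hz
  · exact (periods_of_im_nonneg hz).1 ▸ upperPeriod_im_nonneg _
  · rw [(periods_of_im_neg hz).1, conj_re] at hre
    exact absurd hre (upperPeriod_re_pos (.inr (half_pos (abs_pos.2 hz.ne)).ne')).ne'

/-- The values of `a` lie in a half plane containing no two opposite points. -/
lemma pos_of_a_eq_mul {z z₀ : ℂ} (hz : a z ≠ 0) {c : ℝ} (h : a z = c * a z₀) : 0 < c := by
  by_contra! c_nonpos
  have re_eq : (a z).re = c * (a z₀).re := by rw [h, re_ofReal_mul]
  have im_eq : (a z).im = c * (a z₀).im := by rw [h, im_ofReal_mul]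
  have re_zero : (a z).re = 0 := (re_eq.trans_le
    (mul_nonpos_of_nonpos_of_nonneg c_nonpos (a_re_nonneg z₀))).antisymm (a_re_nonneg z)
  have c_ne_zero : c ≠ 0 := fun hc => hz (by rw [h, hc, ofReal_zero, zero_mul])
  have re_zero₀ : (a z₀).re = 0 := (mul_eq_zero.1 (re_eq.symm.trans re_zero)).resolve_left c_ne_zero
  have im_zero : (a z).im = 0 := (im_eq.trans_le (mul_nonpos_of_nonpos_of_nonneg c_nonpos
    (a_im_nonneg_of_re_eq_zero re_zero₀))).antisymm (a_im_nonneg_of_re_eq_zero re_zero)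
  exact hz (Complex.ext re_zero im_zero)

lemma centralCharge_zero_right (p : ℝ) (z : ℂ) : centralCharge p 0 z = p * a z := by
  rw [centralCharge, ofReal_zero, zero_mul, add_zero]

lemma pos_of_centralCharge_zero_right_eq_mul {p c : ℝ} (hp : p ≠ 0) {z z₀ : ℂ} (hz : a z ≠ 0)
    (h : centralCharge p 0 z = c * centralCharge p 0 z₀) : 0 < c := by
  refine pos_of_a_eq_mul hz (mul_left_cancel₀ (ofReal_ne_zero.2 hp) ?_) (z₀ := z₀)
  rw [← centralCharge_zero_right, h, centralCharge_zero_right, mul_left_comm]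

end Phase

end

end SeibergWitten

theorem mainTheorem1 (p q : ℝ) (hpq : p ≠ 0 ∨ q ≠ 0) (z₀ z : ℂ)
    (hz₀ : z₀ ∈ SeibergWitten.marginalCurve) (hz : z ∈ SeibergWitten.weakRegion)
    (him : (SeibergWitten.centralCharge p q z / SeibergWitten.centralCharge p q z₀).im = 0)
    (hre : q ≠ 0 →
      0 < (SeibergWitten.centralCharge p q z / SeibergWitten.centralCharge p q z₀).re) :
    ‖SeibergWitten.centralCharge p q z₀‖ < ‖SeibergWitten.centralCharge p q z‖ := by
  open SeibergWitten in
  have a_ne_zero : a z ≠ 0 := a_ne_zero_of_notMem_marginalCurve hz.1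
  have p_ne_zero (hq : q = 0) : p ≠ 0 := hpq.resolve_right (not_not.2 hq)
  rcases eq_or_ne (centralCharge p q z₀) 0 with charge₀_zero | charge₀_ne_zero
  · have hq : q = 0 := by
      by_contra hq
      simpa [charge₀_zero] using hre hq
    subst hq
    rw [charge₀_zero, norm_zero, norm_pos_iff, centralCharge_zero_right]
    exact mul_ne_zero (ofReal_ne_zero.2 (p_ne_zero rfl)) a_ne_zero
  obtain ⟨c, ratio_eq⟩ : ∃ c : ℝ, (c : ℂ) = centralCharge p q z / centralCharge p q z₀ :=
    ⟨_, Complex.ext (ofReal_re _) him.symm⟩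
  have charge_eq : centralCharge p q z = c * centralCharge p q z₀ :=
    (div_eq_iff charge₀_ne_zero).1 ratio_eq.symm
  have c_pos : 0 < c := by
    rcases eq_or_ne q 0 with rfl | hq
    · exact pos_of_centralCharge_zero_right_eq_mul (p_ne_zero rfl) a_ne_zero charge_eq
    · simpa [← ratio_eq] using hre hq
  rw [charge_eq, norm_mul, norm_real, Real.norm_of_nonneg c_pos.le]
  exact lt_mul_of_one_lt_left (norm_pos_iff.2 charge₀_ne_zero)
    (one_lt_of_centralCharge_eq_mul hpq c_pos hz₀ hz charge_eq)
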